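/- Let $\mathbb F$ be a finite field and let $d,q\ge 0$ be integers. In the polynomial interpolation problem, coefficients $(a_0,\dots,a_d)\in\mathbb F^{d+1}$ are drawn uniformly at random, and an algorithm that may make $q$ quantum queries to the function $A(x)=\sum_{i=0}^d a_i x^i$ on $\mathbb F$ has to output $(a_0,\dots,a_d)$. An algorithm acts on a finite-dimensional space with orthonormal basis vectors $|x,r,z\rangle$, where $x\in\mathbb F$ and $z$ ranges over a finite workspace of arbitrary size. It starts in a fixed unit vector, applies a fixed unitary (independent of $A$) after each of its $q$ queries, measures in the standard basis, and computes its output from the measured label. A query is either the controlled-add query $|x,g,z\rangle\mapsto|x,g+A(x),z\rangle$, $g\in\mathbb F$, or the phase query $|x,\xi,z\rangle\mapsto\xi(A(x))\,|x,\xi,z\rangle$, $\xi$ a character of $(\mathbb F,+)$. The success probability is the average over the random coefficients of the probability that the output is correct. **Theorem.** The success probability of $q$-query algorithms attains a maximum $P$, which is the same in both query models, and 1. if $q\le \frac d2$, then $P\le \frac1{|\mathbb F|}$; 2. if $q=\frac d2+\frac12$, then $P\ge\frac1{q!}\left(1-\binom{q+1}2\frac1{|\mathbb F|}\right)$, and,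 provided $q\le|\mathbb F|$ (in particular whenever $d<|\mathbb F|$), also $P\le\frac1{q!}$; 3. if $q\ge\frac d2+1$, then $P\ge 1-\dfrac{(\lfloor d/2\rfloor+1)!+d+1}{|\mathbb F|}$. -/

import Mathlib

noncomputable section

namespace QuantumQuery

/-- Pure states of a query register with basis `X`, a response register with basis `R` and a
workspace of dimension `w`; the basis vectors are `|x, r, z⟩`. -/
abbrev StateSpace (X R : Type*) [Fintype X] [Fintype R] (w : ℕ) : Type _ :=
  EuclideanSpace ℂ (X × R × Fin w)

/-- The controlled-add query `|x, g, z⟩ ↦ |x, g + A x, z⟩`: the amplitude of `|x, g, z⟩` after the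
query is the amplitude of `|x, g - A x, z⟩` before it. -/
def addQuery {X G : Type*} [Fintype X] [Fintype G] [AddCommGroup G] (A : X → G) (w : ℕ)
    (ψ : StateSpace X G w) : StateSpace X G w :=
  WithLp.toLp 2 fun b => ψ (b.1, b.2.1 - A b.1, b.2.2)

/-- The phase query `|x, ξ, z⟩ ↦ ξ (A x) |x, ξ, z⟩`, with `ξ` a character of `G`. -/
def phaseQuery {X G : Type*} [Fintype X] [AddCommGroup G] [Fintype (AddChar G ℂ)] (A : X → G)
    (w : ℕ) (ψ : StateSpace X (AddChar G ℂ) w) : StateSpace X (AddChar G ℂ) w :=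
  WithLp.toLp 2 fun b => b.2.1 (A b.1) * ψ b

/-- A quantum query algorithm: an arbitrary finite-dimensional workspace, a unit initial state, a
unitary `step k` applied to all registers after query number `k` (counting from `0`), and a
classical function that turns the outcome of the final measurement in the standard basis into an
output. In a run with `q` queries only `step 0, …, step (q - 1)` are used. -/
structure Algorithm (X R Out : Type*) [Fintype X] [Fintype R] where
  /-- dimension of the workspace -/
  dim : ℕ
  /-- initial state -/
  init : StateSpace X R dim
  norm_init : ‖init‖ = 1
  /-- unitaries between the queries and after the last one -/
  step : ℕ → (StateSpace X R dim ≃ₗᵢ[ℂ] StateSpace X R dim)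
  /-- classical post-processing of the measured basis label -/
  output : X × R × Fin dim → Out

namespace Algorithm

variable {X R Out : Type*} [Fintype X] [Fintype R]

/-- The state after `k` queries, where `query` is the action of one query. -/
def state (𝒬 : Algorithm X R Out) (query : StateSpace X R 𝒬.dim → StateSpace X R 𝒬.dim) :
    ℕ → StateSpace X R 𝒬.dim
  | 0 => 𝒬.init
  | k + 1 => 𝒬.step k (query (𝒬.state query k))

open Classical in
/-- The probability that the algorithm outputs `o` after `q` queries. -/
def outputProb (𝒬 : Algorithm X R Out) (query : StateSpace X R 𝒬.dim → StateSpace X R 𝒬.dim)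
    (q : ℕ) (o : Out) : ℝ :=
  ∑ b : X × R × Fin 𝒬.dim, if 𝒬.output b = o then ‖𝒬.state query q b‖ ^ 2 else 0

end Algorithm

/-- The function computed by the polynomial `∑ aᵢ xⁱ` of degree at most `d`. -/
def polyFun {F : Type*} [Field F] {d : ℕ} (a : Fin (d + 1) → F) (x : F) : F :=
  ∑ i, a i * x ^ (i : ℕ)

/-- All success probabilities that algorithms with `q` queries achieve in polynomial
interpolation: the `d + 1` coefficients are uniformly random, and the algorithm succeeds when it
outputs all of them. The parameter `query A w` is the action of a query to the function `A` on
states with a workspace of dimension `w`. -/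
def interpolationProbs {F R : Type*} [Field F] [Fintype F] [Fintype R]
    (query : (F → F) → (w : ℕ) → StateSpace F R w → StateSpace F R w) (d q : ℕ) : Set ℝ :=
  {p | ∃ 𝒬 : Algorithm F R (Fin (d + 1) → F),
    p = (∑ a : Fin (d + 1) → F, 𝒬.outputProb (query (polyFun a) 𝒬.dim) q a) /
      (Fintype.card F : ℝ) ^ (d + 1)}

end QuantumQuery

end

/-!
The Fourier transform of the response register turns controlled-add queries into phase queries,
and a phase query labelled `x, ξ` multiplies the amplitude by the character `A ↦ ξ (A x)`. After
`q` queries the state is therefore a combination, with coefficients independent of the hidden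
vector, of characters from the set `S` of products of `q` such characters; the final states span
at most `#S` dimensions, which bounds the success probability by `#S` over the number of hidden
vectors. Running the `#S` products in superposition and measuring in the Fourier basis attains
this bound.

For polynomials of degree at most `d`, the set `S` is in bijection with the set of linear
combinations of at most `q` of the vectors `(1, x, …, x ^ d)`, any `d + 1` of which are linearly
independent. Hence combinations of `k` of these vectors are distinct when `2 * k ≤ d + 1`, while
for `2 * k = d + 2` there are few coincidences and Cauchy–Schwarz shows that the combinations fill
almost the whole space. For odd `d`, the vector of the node `0` is spent on adjusting the first
coordinate after solving the problem for `d - 1` on the nonzero nodes.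
-/

noncomputable section

open Finset Matrix
open scoped Pointwise

namespace QuantumQuery

section LinearAlgebra

variable {𝕜 E : Type*} [RCLike 𝕜] [NormedAddCommGroup E] [InnerProductSpace 𝕜 E]

theorem sum_norm_sq_starProjection_orthonormalBasis {ι : Type*} [Fintype ι]
    (b : OrthonormalBasis ι 𝕜 E) (W : Submodule 𝕜 E) [W.HasOrthogonalProjection] :
    ∑ i, ‖W.starProjection (b i)‖ ^ 2 = Module.finrank 𝕜 W := by
  have : FiniteDimensional 𝕜 E := b.toBasis.finiteDimensional_of_finite
  have htrace : LinearMap.trace 𝕜 E W.starProjection = Module.finrank 𝕜 W :=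
    LinearMap.IsProj.trace
      ⟨fun x => W.starProjection_apply_mem x, fun x hx => W.starProjection_eq_self_iff.2 hx⟩
  rw [LinearMap.trace_eq_sum_inner _ b] at htrace
  have hre := congrArg RCLike.re htrace
  simp only [map_sum, ContinuousLinearMap.coe_coe, RCLike.natCast_re] at hre
  rw [← hre]
  refine sum_congr rfl fun i _ => ?_
  rw [inner_re_symm, W.re_inner_starProjection_eq_normSq, W.starProjection_apply,
    Submodule.coe_norm]

theorem sum_norm_sq_inner_orthonormalBasis_le_finrank {ι : Type*} [Fintype ι]
    (b : OrthonormalBasis ι 𝕜 E) (W : Submodule 𝕜 E) [W.HasOrthogonalProjection] {φ : ι → E}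
    (hmem : ∀ i, φ i ∈ W) (hnorm : ∀ i, ‖φ i‖ ≤ 1) :
    ∑ i, ‖inner 𝕜 (b i) (φ i)‖ ^ 2 ≤ Module.finrank 𝕜 W := by
  rw [← sum_norm_sq_starProjection_orthonormalBasis b W]
  gcongr with i
  calc ‖inner 𝕜 (b i) (φ i)‖ = ‖inner 𝕜 (W.starProjection (b i)) (φ i)‖ := by
        rw [W.inner_starProjection_left_eq_right, W.starProjection_eq_self_iff.2 (hmem i)]
    _ ≤ ‖W.starProjection (b i)‖ * ‖φ i‖ := norm_inner_le_norm _ _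
    _ ≤ ‖W.starProjection (b i)‖ := mul_le_of_le_one_right (norm_nonneg _) (hnorm i)

theorem exists_linearIsometryEquiv_of_orthonormal [FiniteDimensional 𝕜 E] {ι : Type*} {u v : ι → E}
    (hu : Orthonormal 𝕜 u) (hv : Orthonormal 𝕜 v) : ∃ U : E ≃ₗᵢ[𝕜] E, ∀ i, U (u i) = v i := by
  let b := Module.Basis.span hu.linearIndependent
  have hb_apply (i) : (b i : E) = u i :=
    congrArg Subtype.val (Module.Basis.span_apply hu.linearIndependent i)
  have hb : Orthonormal 𝕜 b := by
    rw [← (Submodule.subtypeₗᵢ _).orthonormal_comp_iff]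
    convert hu using 1
    exact funext hb_apply
  let L : Submodule.span 𝕜 (Set.range u) →ₗᵢ[𝕜] E :=
    (b.constr 𝕜 v).isometryOfOrthonormal hb
      (by simpa only [Function.comp_def, b.constr_basis] using hv)
  refine ⟨L.extend.toLinearIsometryEquiv rfl, fun i => ?_⟩
  calc L.extend (u i) = L (b i) := by rw [← hb_apply, L.extend_apply]
    _ = v i := b.constr_basis 𝕜 v i

theorem norm_sum_smul_orthonormal {J : Type*} [Fintype J] {u : J → E} (hu : Orthonormal 𝕜 u)
    (c : EuclideanSpace 𝕜 J) : ‖∑ j, c j • u j‖ = ‖c‖ := by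
  rw [← sq_eq_sq₀ (norm_nonneg _) (norm_nonneg _), EuclideanSpace.norm_sq_eq,
    ← RCLike.ofReal_inj (K := 𝕜), RCLike.ofReal_pow, ← inner_self_eq_norm_sq_to_K, hu.inner_sum]
  simp [RCLike.conj_mul]

end LinearAlgebra

section Fourier

variable {G κ : Type*} [AddCommGroup G] [Fintype G]

theorem sum_conj_addChar_mul_addChar (χ ξ : AddChar G ℂ) [Decidable (χ = ξ)] :
    ∑ g, starRingEnd ℂ (χ g) * ξ g = if χ = ξ then (Fintype.card G : ℂ) else 0 := by
  classical
  have h := AddChar.sum_eq_ite (χ⁻¹ * ξ)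
  simpa only [AddChar.mul_apply, AddChar.inv_apply, AddChar.map_neg_eq_conj, ← AddChar.one_eq_zero,
    inv_mul_eq_one] using h

variable [DecidableEq κ]

/-- The Fourier vector `|G|^(-1/2) ∑ g, conj (χ g) |s g⟩`, supported on a copy `s` of `G` inside
the set of basis labels. -/
def fourierVec (s : G ↪ κ) (χ : AddChar G ℂ) : EuclideanSpace ℂ κ :=
  ∑ g, (starRingEnd ℂ (χ g) / (√(Fintype.card G) : ℝ)) • EuclideanSpace.single (s g) 1

theorem fourierVec_apply (s : G ↪ κ) (χ : AddChar G ℂ) (g : G) :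
    fourierVec s χ (s g) = starRingEnd ℂ (χ g) / (√(Fintype.card G) : ℝ) := by
  classical
  simp [fourierVec, Pi.single_apply]

theorem norm_sq_sum_smul_fourierVec_apply (s : G ↪ κ) {J : Type*} [Fintype J]
    (χ : J → AddChar G ℂ) (g : G) :
    ‖(∑ j, (((√(Fintype.card J))⁻¹ : ℝ) * χ j g) • fourierVec s (χ j)) (s g)‖ ^ 2 =
      Fintype.card J / Fintype.card G := by
  have hterm (j : J) : (((√(Fintype.card J))⁻¹ : ℝ) * χ j g) * fourierVec s (χ j) (s g) =
      ((√(Fintype.card J))⁻¹ / √(Fintype.card G) : ℝ) := by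
    have hχ : χ j g * starRingEnd ℂ (χ j g) = 1 := by simp [Complex.mul_conj']
    rw [fourierVec_apply, ← mul_div_assoc, mul_assoc, hχ]
    simp
  simp only [WithLp.ofLp_sum, WithLp.ofLp_smul, Finset.sum_apply, Pi.smul_apply, smul_eq_mul, hterm]
  rw [sum_const, card_univ, nsmul_eq_mul, ← Complex.ofReal_natCast, ← Complex.ofReal_mul,
    Complex.norm_real, Real.norm_eq_abs, sq_abs, mul_pow, div_pow, inv_pow,
    Real.sq_sqrt (Nat.cast_nonneg _), Real.sq_sqrt (Nat.cast_nonneg _)]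
  rcases Nat.eq_zero_or_pos (Fintype.card J) with hJ | hJ
  · simp [hJ]
  · field_simp

variable [Fintype κ]

theorem inner_fourierVec (s : G ↪ κ) (χ : AddChar G ℂ) (ψ : EuclideanSpace ℂ κ) :
    inner ℂ (fourierVec s χ) ψ = ∑ g, χ g / (√(Fintype.card G) : ℝ) * ψ (s g) := by
  simp only [fourierVec, sum_inner, inner_smul_left, EuclideanSpace.inner_single_left, map_div₀,
    map_one, Complex.conj_conj, Complex.conj_ofReal, one_mul]

theorem orthonormal_fourierVec (s : G ↪ κ) : Orthonormal ℂ (fourierVec s) := by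
  classical
  have : (Fintype.card G : ℂ) ≠ 0 := Nat.cast_ne_zero.2 Fintype.card_ne_zero
  have hsqrt : (√(Fintype.card G) : ℂ) * (√(Fintype.card G) : ℝ) = Fintype.card G := by
    rw [← Complex.ofReal_mul, Real.mul_self_sqrt (Nat.cast_nonneg _), Complex.ofReal_natCast]
  rw [orthonormal_iff_ite]
  intro χ ξ
  calc inner ℂ (fourierVec s χ) (fourierVec s ξ)
      = (∑ g, starRingEnd ℂ (ξ g) * χ g) / Fintype.card G := by
        rw [inner_fourierVec, sum_div]
        refine sum_congr rfl fun g _ => ?_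
        rw [fourierVec_apply, div_mul_div_comm, hsqrt, mul_comm]
    _ = if χ = ξ then 1 else 0 := by
        rw [sum_conj_addChar_mul_addChar]
        split_ifs <;> simp_all

theorem inner_fourierVec_of_disjoint {s t : G ↪ κ} (hst : ∀ g h, s g ≠ t h) (χ ξ : AddChar G ℂ) :
    inner ℂ (fourierVec s χ) (fourierVec t ξ) = 0 := by
  rw [inner_fourierVec]
  refine sum_eq_zero fun g _ => ?_
  simp [fourierVec, hst]

end Fourier

section QueryModels

variable {X R G : Type*} [Fintype X] [Fintype R] [AddCommGroup G] [Fintype G]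

/-- A query model is phase equivalent if a unitary change of basis, independent of the queried
function, turns its queries into phase queries. -/
def PhaseEquivalent (query : (X → G) → (w : ℕ) → StateSpace X R w → StateSpace X R w) : Prop :=
  ∀ w, ∃ Φ : StateSpace X R w ≃ₗᵢ[ℂ] StateSpace X (AddChar G ℂ) w,
    ∀ A ψ, Φ (query A w ψ) = phaseQuery A w (Φ ψ)

theorem phaseEquivalent_phaseQuery : PhaseEquivalent (phaseQuery (X := X) (G := G)) :=
  fun _ => ⟨LinearIsometryEquiv.refl ℂ _, fun _ _ => rfl⟩

theorem phaseEquivalent_addQuery : PhaseEquivalent (addQuery (X := X) (G := G)) := by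
  classical
  intro w
  let s (x : X) (z : Fin w) : G ↪ X × G × Fin w := ⟨fun g => (x, g, z), fun g h => by simp⟩
  let v (i : X × AddChar G ℂ × Fin w) : StateSpace X G w := fourierVec (s i.1 i.2.2) i.2.1
  have hv : Orthonormal ℂ v := by
    rw [orthonormal_iff_ite]
    rintro ⟨x, χ, z⟩ ⟨y, ξ, z'⟩
    by_cases hxz : x = y ∧ z = z'
    · obtain ⟨rfl, rfl⟩ := hxz
      simpa [v] using orthonormal_iff_ite.1 (orthonormal_fourierVec (s x z)) χ ξ
    · rw [if_neg (by grind)]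
      exact inner_fourierVec_of_disjoint
        (fun g h hgh => hxz ⟨congrArg Prod.fst hgh, congrArg (·.2.2) hgh⟩) χ ξ
  have hcard : Fintype.card (X × AddChar G ℂ × Fin w) = Module.finrank ℂ (StateSpace X G w) := by
    simp [AddChar.card_eq]
  let b := OrthonormalBasis.mk hv (hv.linearIndependent.span_eq_top_of_card_eq_finrank' hcard).ge
  have hb (ψ x ξ z) : b.repr ψ (x, ξ, z) = ∑ g, ξ g / (√(Fintype.card G) : ℝ) * ψ (x, g, z) := by
    rw [b.repr_apply_apply, OrthonormalBasis.coe_mk]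
    exact inner_fourierVec (s x z) ξ ψ
  refine ⟨b.repr, fun A ψ => ?_⟩
  ext ⟨x, ξ, z⟩
  calc b.repr (addQuery A w ψ) (x, ξ, z)
      = ∑ g, ξ (g + A x) / (√(Fintype.card G) : ℝ) * ψ (x, g, z) := by
        rw [hb, ← Equiv.sum_comp (Equiv.addRight (A x))]
        simp [addQuery]
    _ = ξ (A x) * b.repr ψ (x, ξ, z) := by
        rw [hb, mul_sum]
        refine sum_congr rfl fun g _ => ?_
        rw [AddChar.map_add_eq_mul]
        ring

variable {query : (X → G) → (w : ℕ) → StateSpace X R w → StateSpace X R w}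

namespace PhaseEquivalent

theorem norm_query (h : PhaseEquivalent query) (A : X → G) (w : ℕ) (ψ : StateSpace X R w) :
    ‖query A w ψ‖ = ‖ψ‖ := by
  obtain ⟨Φ, hΦ⟩ := h w
  rw [← Φ.norm_map, hΦ, ← Φ.norm_map ψ, EuclideanSpace.norm_eq, EuclideanSpace.norm_eq]
  simp [phaseQuery]

theorem norm_state (h : PhaseEquivalent query) {Out : Type*} (𝒬 : Algorithm X R Out) (A : X → G)
    (k : ℕ) : ‖𝒬.state (query A 𝒬.dim) k‖ = 1 := by
  induction k with
  | zero => exact 𝒬.norm_init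
  | succ k ih => rw [Algorithm.state, LinearIsometryEquiv.norm_map, h.norm_query, ih]

theorem exists_orthonormal_query_sum_eq (h : PhaseEquivalent query) {w : ℕ} {J : Type*} [Fintype J]
    (z : J ↪ Fin w) (p : J → X × AddChar G ℂ) :
    ∃ u : J → StateSpace X R w, Orthonormal ℂ u ∧ ∀ A (c : J → ℂ),
      query A w (∑ j, c j • u j) = ∑ j, (c j * (p j).2 (A (p j).1)) • u j := by
  classical
  obtain ⟨Φ, hΦ⟩ := h w
  let label (j : J) : X × AddChar G ℂ × Fin w := ((p j).1, (p j).2, z j)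
  have hlabel : Function.Injective label := fun i j hij => z.injective (congrArg (·.2.2) hij)
  let e (j : J) : StateSpace X (AddChar G ℂ) w := EuclideanSpace.single (label j) 1
  refine ⟨fun j => Φ.symm (e j), ?_, fun A c => Φ.injective ?_⟩
  · exact ((EuclideanSpace.orthonormal_single).comp label hlabel).comp_linearIsometryEquiv Φ.symm
  · rw [hΦ]
    simp only [map_sum, map_smul, LinearIsometryEquiv.apply_symm_apply]
    ext b
    simp only [phaseQuery, WithLp.ofLp_sum, WithLp.ofLp_smul, Finset.sum_apply, Pi.smul_apply,
      smul_eq_mul, mul_sum]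
    refine sum_congr rfl fun j _ => ?_
    by_cases hb : b = label j
    · subst hb
      simp only [label]
      ring
    · simp [e, hb]

end PhaseEquivalent

namespace Algorithm

variable {Out : Type*}

theorem sum_outputProb [Fintype Out] (𝒬 : Algorithm X R Out)
    (query : Out → StateSpace X R 𝒬.dim → StateSpace X R 𝒬.dim) (q : ℕ) :
    ∑ o, 𝒬.outputProb (query o) q o =
      ∑ b, ‖𝒬.state (query (𝒬.output b)) q b‖ ^ 2 := by
  classical
  simp only [outputProb]
  rw [sum_comm]
  simp

theorem norm_sq_state_le_outputProb (𝒬 : Algorithm X R Out)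
    (query : StateSpace X R 𝒬.dim → StateSpace X R 𝒬.dim) (q : ℕ) (b : X × R × Fin 𝒬.dim) :
    ‖𝒬.state query q b‖ ^ 2 ≤ 𝒬.outputProb query q (𝒬.output b) := by
  classical
  simpa [outputProb] using single_le_sum
    (f := fun b' => if 𝒬.output b' = 𝒬.output b then ‖𝒬.state query q b'‖ ^ 2 else 0)
    (fun b' _ => by positivity) (mem_univ b)

variable {w : ℕ} {J : Type*} [Fintype J]

/-- The algorithm that starts in the superposition of the vectors `u 0 j` with amplitudes `c j` and
after query number `k` carries each `u k j` to `u (k + 1) j`. -/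
def transport (u : ℕ → J → StateSpace X R w) (hu : ∀ k, Orthonormal ℂ (u k))
    (c : EuclideanSpace ℂ J) (hc : ‖c‖ = 1) (output : X × R × Fin w → Out) :
    Algorithm X R Out where
  dim := w
  init := ∑ j, c j • u 0 j
  norm_init := by rw [norm_sum_smul_orthonormal (hu 0), hc]
  step k := (exists_linearIsometryEquiv_of_orthonormal (hu k) (hu (k + 1))).choose
  output := output

theorem state_transport {u : ℕ → J → StateSpace X R w} (hu : ∀ k, Orthonormal ℂ (u k))
    {c : EuclideanSpace ℂ J} (hc : ‖c‖ = 1) (output : X × R × Fin w → Out) {q : ℕ}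
    {Q : StateSpace X R w → StateSpace X R w} {φ : ℕ → J → ℂ}
    (hQ : ∀ k < q, ∀ c : J → ℂ, Q (∑ j, c j • u k j) = ∑ j, (c j * φ k j) • u k j) :
    (transport u hu c hc output).state Q q = ∑ j, (c j * ∏ k ∈ range q, φ k j) • u q j := by
  induction q with
  | zero => simp [state, transport]
  | succ q ih =>
    let U := (exists_linearIsometryEquiv_of_orthonormal (hu q) (hu (q + 1))).choose
    have hU : ∀ j, U (u q j) = u (q + 1) j :=
      (exists_linearIsometryEquiv_of_orthonormal (hu q) (hu (q + 1))).choose_spec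
    change U (Q ((transport u hu c hc output).state Q q)) = _
    rw [ih fun k hk => hQ k (hk.trans q.lt_succ_self), hQ q q.lt_succ_self]
    simp only [map_sum, map_smul, hU, prod_range_succ, mul_assoc]

end Algorithm

end QueryModels

section Identification

variable {X R G H : Type*} [AddCommGroup G] [AddCommGroup H]

/-- The character `a ↦ ξ (ev a x)` of the group of hidden elements, by which the phase query to
`ev a` multiplies the basis vectors labelled `x, ξ`. -/
def evalChar (ev : H →+ X → G) (p : X × AddChar G ℂ) : AddChar H ℂ :=
  p.2.compAddMonoidHom ((Pi.evalAddMonoidHom _ p.1).comp ev)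

theorem evalChar_apply (ev : H →+ X → G) (p : X × AddChar G ℂ) (a : H) :
    evalChar ev p a = p.2 (ev a p.1) := rfl

/-- The characters of the group of hidden elements that `q` phase queries can produce. -/
def evalChars (ev : H →+ X → G) (q : ℕ) : Set (AddChar H ℂ) :=
  Set.range (evalChar ev) ^ q

theorem exists_prod_evalChar_eq [Nonempty X] {ev : H →+ X → G} {q : ℕ} {χ : AddChar H ℂ}
    (hχ : χ ∈ evalChars ev q) :
    ∃ p : ℕ → X × AddChar G ℂ, ∏ k ∈ range q, evalChar ev (p k) = χ := by
  obtain ⟨f, rfl⟩ := Set.mem_pow.1 hχ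
  choose p hp using fun i => (f i).2
  refine ⟨fun k => if hk : k < q then p ⟨k, hk⟩ else Classical.arbitrary _, ?_⟩
  simp [prod_range, List.prod_ofFn, hp]

theorem evalChars_nonempty [Nonempty X] (ev : H →+ X → G) (q : ℕ) : (evalChars ev q).Nonempty :=
  (Set.range_nonempty _).pow

variable [Fintype X] [Fintype R] [Fintype G]
  {query : (X → G) → (w : ℕ) → StateSpace X R w → StateSpace X R w}

namespace PhaseEquivalent

theorem exists_query_eq_sum [Finite H] (h : PhaseEquivalent query) (ev : H →+ X → G) {k w : ℕ}
    {v : AddChar H ℂ → StateSpace X R w} (hv : ∀ χ ∉ evalChars ev k, v χ = 0) :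
    ∃ v' : AddChar H ℂ → StateSpace X R w, (∀ χ ∉ evalChars ev (k + 1), v' χ = 0) ∧
      ∀ a, query (ev a) w (∑ χ, χ a • v χ) = ∑ χ, χ a • v' χ := by
  obtain ⟨Φ, hΦ⟩ := h w
  let θ (i : X × AddChar G ℂ × Fin w) : AddChar H ℂ := evalChar ev (i.1, i.2.1)
  refine ⟨fun χ => Φ.symm (WithLp.toLp 2 fun i => Φ (v (χ * (θ i)⁻¹)) i), fun χ hχ => ?_,
    fun a => Φ.injective ?_⟩
  · rw [map_eq_zero_iff _ Φ.symm.injective]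
    ext i
    have : χ * (θ i)⁻¹ ∉ evalChars ev k := fun hmem => hχ <| by
      rw [← inv_mul_cancel_right χ (θ i)]
      exact Set.mul_mem_mul hmem ⟨_, rfl⟩
    simp [hv _ this]
  · ext i
    rw [hΦ]
    simp only [phaseQuery, map_sum, map_smul, LinearIsometryEquiv.apply_symm_apply,
      WithLp.ofLp_sum, WithLp.ofLp_smul, Finset.sum_apply, Pi.smul_apply, smul_eq_mul, mul_sum]
    rw [← Equiv.sum_comp (Equiv.mulRight (θ i)) fun χ => χ a * Φ (v (χ * (θ i)⁻¹)) i]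
    refine sum_congr rfl fun χ _ => ?_
    rw [Equiv.coe_mulRight, mul_inv_cancel_right, AddChar.mul_apply, evalChar_apply]
    ring

theorem exists_state_eq_sum [Finite H] (h : PhaseEquivalent query) (ev : H →+ X → G)
    {Out : Type*} (𝒬 : Algorithm X R Out) (k : ℕ) :
    ∃ v : AddChar H ℂ → StateSpace X R 𝒬.dim, (∀ χ ∉ evalChars ev k, v χ = 0) ∧
      ∀ a, 𝒬.state (query (ev a) 𝒬.dim) k = ∑ χ, χ a • v χ := by
  classical
  induction k with
  | zero =>
    exact ⟨Pi.single 1 𝒬.init, fun χ hχ => Pi.single_eq_of_ne hχ _, fun a => by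
      simp [Algorithm.state, Pi.single_apply]⟩
  | succ k ih =>
    obtain ⟨v, hv, hstate⟩ := ih
    obtain ⟨v', hv', hquery⟩ := h.exists_query_eq_sum ev hv
    refine ⟨fun χ => 𝒬.step k (v' χ), fun χ hχ => by simp only [hv' χ hχ, map_zero], fun a => ?_⟩
    rw [Algorithm.state, hstate, hquery]
    simp only [map_sum, map_smul]

end PhaseEquivalent

variable [Fintype H]

/-- The success probabilities of algorithms that identify a uniformly random element `a` of the
finite abelian group `H` by `q` queries to the function `ev a`. -/
def identificationProbs (query : (X → G) → (w : ℕ) → StateSpace X R w → StateSpace X R w)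
    (ev : H →+ X → G) (q : ℕ) : Set ℝ :=
  {p | ∃ 𝒬 : Algorithm X R H,
    p = (∑ a, 𝒬.outputProb (query (ev a) 𝒬.dim) q a) / Fintype.card H}

namespace PhaseEquivalent

theorem sum_outputProb_le (h : PhaseEquivalent query) (ev : H →+ X → G) (𝒬 : Algorithm X R H)
    (q : ℕ) : ∑ a, 𝒬.outputProb (query (ev a) 𝒬.dim) q a ≤ (evalChars ev q).ncard := by
  classical
  obtain ⟨v, hv, hstate⟩ := h.exists_state_eq_sum ev 𝒬 q
  let W := Submodule.span ℂ (v '' evalChars ev q)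
  have hmem (a) : 𝒬.state (query (ev a) 𝒬.dim) q ∈ W := by
    rw [hstate]
    refine W.sum_mem fun χ _ => W.smul_mem _ ?_
    by_cases hχ : χ ∈ evalChars ev q
    · exact Submodule.subset_span ⟨χ, hχ, rfl⟩
    · exact hv χ hχ ▸ W.zero_mem
  calc ∑ a, 𝒬.outputProb (query (ev a) 𝒬.dim) q a
      = ∑ b, ‖inner ℂ (EuclideanSpace.basisFun _ ℂ b)
          (𝒬.state (query (ev (𝒬.output b)) 𝒬.dim) q)‖ ^ 2 := by
        rw [𝒬.sum_outputProb fun a => query (ev a) 𝒬.dim]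
        simp [EuclideanSpace.inner_single_left]
    _ ≤ Module.finrank ℂ W :=
        sum_norm_sq_inner_orthonormalBasis_le_finrank _ W (fun b => hmem _)
          fun b => (h.norm_state 𝒬 _ q).le
    _ ≤ (evalChars ev q).ncard := by
        refine Nat.cast_le.2 ((finrank_span_le_card _).trans ?_)
        rw [← Set.ncard_eq_toFinset_card']
        exact Set.ncard_image_le

theorem exists_orthonormal_query_trajectory [Nonempty X] (h : PhaseEquivalent query)
    (ev : H →+ X → G) (q : ℕ) [Fintype (evalChars ev q)]
    [DecidableEq (X × R × Fin (Fintype.card H))] (s : H ↪ X × R × Fin (Fintype.card H)) :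
    ∃ (u : ℕ → evalChars ev q → StateSpace X R (Fintype.card H))
      (φ : ℕ → evalChars ev q → AddChar H ℂ),
      (∀ k, Orthonormal ℂ (u k)) ∧ (∀ χ, u q χ = fourierVec s χ) ∧
      (∀ χ, ∏ k ∈ range q, φ k χ = χ) ∧
      ∀ k < q, ∀ a (c : evalChars ev q → ℂ),
        query (ev a) _ (∑ χ, c χ • u k χ) = ∑ χ, (c χ * φ k χ a) • u k χ := by
  choose p hp using fun χ : evalChars ev q => exists_prod_evalChar_eq χ.2
  let z : evalChars ev q ↪ Fin (Fintype.card H) :=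
    (Function.Embedding.subtype _).trans (Fintype.equivFinOfCardEq AddChar.card_eq).toEmbedding
  choose u₀ hu₀ hquery using fun k => h.exists_orthonormal_query_sum_eq z fun χ => p χ k
  refine ⟨fun k χ => if k < q then u₀ k χ else fourierVec s χ, fun k χ => evalChar ev (p χ k),
    fun k => ?_, fun χ => if_neg q.lt_irrefl, hp, fun k hk a c => ?_⟩
  · by_cases hk : k < q
    · simpa only [if_pos hk] using hu₀ k
    · simpa only [if_neg hk, Function.comp_def] using
        (orthonormal_fourierVec s).comp _ Subtype.val_injective
  · simpa only [if_pos hk, evalChar_apply] using hquery k (ev a) c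

theorem exists_ncard_le_sum_outputProb [Nonempty X] [Nonempty R] (h : PhaseEquivalent query)
    (ev : H →+ X → G) (q : ℕ) : ∃ 𝒬 : Algorithm X R H,
      (evalChars ev q).ncard ≤ ∑ a, 𝒬.outputProb (query (ev a) 𝒬.dim) q a := by
  classical
  let S := evalChars ev q
  have : Nonempty S := (evalChars_nonempty ev q).to_subtype
  let r : X × R := Classical.arbitrary _
  let s : H ↪ X × R × Fin (Fintype.card H) :=
    ⟨fun a => (r.1, r.2, Fintype.equivFin H a), fun a b hab => by simpa using hab⟩
  obtain ⟨u, φ, hu, hu_last, hφ, hquery⟩ := h.exists_orthonormal_query_trajectory ev q s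
  let c : EuclideanSpace ℂ S := WithLp.toLp 2 fun _ => ((√(Fintype.card S))⁻¹ : ℝ)
  have hc : ‖c‖ = 1 := by
    simp [c, EuclideanSpace.norm_eq]
  let output (b : X × R × Fin (Fintype.card H)) : H := (Fintype.equivFin H).symm b.2.2
  have houtput (a : H) : output (s a) = a := (Fintype.equivFin H).symm_apply_apply a
  let 𝒬 := Algorithm.transport u hu c hc output
  have hstate (a : H) :
      𝒬.state (query (ev a) 𝒬.dim) q = ∑ χ : S, (c χ * χ.1 a) • fourierVec s χ := by
    refine (Algorithm.state_transport hu hc output fun k hk => hquery k hk a).trans ?_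
    simp only [← AddChar.prod_apply, hφ, hu_last]
    rfl
  refine ⟨𝒬, ?_⟩
  calc (S.ncard : ℝ) = ∑ _a : H, (Fintype.card S / Fintype.card H : ℝ) := by
        rw [sum_const, card_univ, nsmul_eq_mul, mul_div_cancel₀ _ (by simp),
          Set.ncard_eq_toFinset_card', Set.toFinset_card]
    _ ≤ ∑ a, 𝒬.outputProb (query (ev a) 𝒬.dim) q a := by
        refine sum_le_sum fun a _ => ?_
        calc (Fintype.card S / Fintype.card H : ℝ)
            = ‖𝒬.state (query (ev a) 𝒬.dim) q (s a)‖ ^ 2 := by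
              rw [hstate, ← norm_sq_sum_smul_fourierVec_apply s (fun χ : S => χ.1) a]
          _ ≤ 𝒬.outputProb (query (ev a) 𝒬.dim) q (output (s a)) :=
              𝒬.norm_sq_state_le_outputProb (query (ev a) 𝒬.dim) q (s a)
          _ = 𝒬.outputProb (query (ev a) 𝒬.dim) q a := by rw [houtput]

theorem isGreatest_identificationProbs [Nonempty X] [Nonempty R] (h : PhaseEquivalent query)
    (ev : H →+ X → G) (q : ℕ) :
    IsGreatest (identificationProbs query ev q) ((evalChars ev q).ncard / Fintype.card H) := by
  obtain ⟨𝒬, h𝒬⟩ := h.exists_ncard_le_sum_outputProb ev q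
  refine ⟨⟨𝒬, ?_⟩, ?_⟩
  · rw [h𝒬.antisymm (h.sum_outputProb_le ev 𝒬 q)]
  · rintro _ ⟨𝒬', rfl⟩
    gcongr
    exact h.sum_outputProb_le ev 𝒬' q

end PhaseEquivalent

end Identification

section SparseCombinations

variable {X : Type*} (K : Type*) {V : Type*} [Ring K] [AddCommGroup V] [Module K V]

/-- The linear combinations of at most `q` members of the family `v`. -/
def sparseCombinations (v : X → V) (q : ℕ) : Set V :=
  Finsupp.linearCombination K v '' {f | #f.support ≤ q}

variable {K}

theorem sparseCombinations_zero (v : X → V) : sparseCombinations K v 0 = {0} := by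
  simp [sparseCombinations]

theorem sparseCombinations_mono (v : X → V) : Monotone (sparseCombinations K v) :=
  fun _ _ h => Set.image_mono fun _ hf => hf.trans h

theorem sparseCombinations_succ [Nonempty X] (v : X → V) (q : ℕ) :
    sparseCombinations K v (q + 1) =
      Set.image2 (fun y p => y + p.2 • v p.1) (sparseCombinations K v q)
        (Set.univ : Set (X × K)) := by
  classical
  ext y
  constructor
  · rintro ⟨f, hf, rfl⟩
    obtain ⟨x, hx⟩ : ∃ x, #(f.erase x).support ≤ q := by
      rcases f.support.eq_empty_or_nonempty with h0 | ⟨x, hx⟩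
      · exact ⟨Classical.arbitrary X, by simp [h0]⟩
      · refine ⟨x, ?_⟩
        rw [Finsupp.support_erase, card_erase_of_mem hx]
        exact Nat.sub_le_of_le_add hf
    refine ⟨_, ⟨f.erase x, hx, rfl⟩, (x, f x), Set.mem_univ _, ?_⟩
    dsimp only
    rw [← Finsupp.linearCombination_single, ← map_add, Finsupp.erase_add_single]
  · rintro ⟨_, ⟨f, hf, rfl⟩, ⟨x, c⟩, -, rfl⟩
    refine ⟨f + Finsupp.single x c, ?_, by simp⟩
    calc #(f + Finsupp.single x c).support
        ≤ #f.support + #(Finsupp.single x c).support :=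
          (card_le_card Finsupp.support_add).trans (card_union_le _ _)
      _ ≤ q + 1 := add_le_add hf ((card_le_card Finsupp.support_single_subset).trans_eq (by simp))

theorem finite_sparseCombinations [Finite X] [Finite K] (v : X → V) (q : ℕ) :
    (sparseCombinations K v q).Finite := by
  have : Finite (X →₀ K) := Finite.of_injective _ DFunLike.coe_injective
  exact (Set.toFinite _).image _

theorem ncard_sparseCombinations_le_pow [Finite X] [Nonempty X] [Finite K] (v : X → V) (q : ℕ) :
    (sparseCombinations K v q).ncard ≤ (Nat.card X * Nat.card K) ^ q := by
  induction q with
  | zero => simp [sparseCombinations_zero]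
  | succ q ih =>
    rw [sparseCombinations_succ, ← Set.image_prod, pow_succ]
    calc _ ≤ ((sparseCombinations K v q) ×ˢ (Set.univ : Set (X × K))).ncard :=
          Set.ncard_image_le ((finite_sparseCombinations v q).prod Set.finite_univ)
      _ ≤ _ := by
          rw [Set.ncard_prod, Set.ncard_univ, Nat.card_prod]
          gcongr

theorem ncard_sparseCombinations_le_choose_mul_pow [Fintype X] [Fintype K] (v : X → V) {q : ℕ}
    (hq : q ≤ Fintype.card X) :
    (sparseCombinations K v q).ncard ≤ (Fintype.card X).choose q * Fintype.card K ^ q := by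
  classical
  let s : Finset (X →₀ K) := (powersetCard q univ).biUnion fun S => S.finsupp fun _ => univ
  have hs : {f : X →₀ K | #f.support ≤ q} ⊆ s := by
    intro f hf
    obtain ⟨S, hfS, -, hS⟩ := exists_subsuperset_card_eq f.support.subset_univ hf hq
    simpa [s, Finset.mem_finsupp_iff] using ⟨S, hS, hfS⟩
  calc (sparseCombinations K v q).ncard ≤ #s := by
        rw [← Set.ncard_coe_finset s]
        exact (Set.ncard_image_le (s.finite_toSet.subset hs)).trans (Set.ncard_le_ncard hs)
    _ ≤ ∑ S ∈ powersetCard q (univ : Finset X), #(S.finsupp fun _ => (univ : Finset K)) :=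
        card_biUnion_le
    _ = ∑ _S ∈ powersetCard q (univ : Finset X), Fintype.card K ^ q := by
        refine sum_congr rfl fun S hS => ?_
        rw [card_finsupp, prod_const, card_univ, (mem_powersetCard.1 hS).2]
    _ = (Fintype.card X).choose q * Fintype.card K ^ q := by
        rw [sum_const, card_powersetCard, card_univ, smul_eq_mul]

end SparseCombinations

section LinearOracle

variable {K X ι : Type*} [CommRing K] [Fintype ι]

/-- The character `a ↦ e (y ⬝ᵥ a)` of the additive group of vectors. -/
def dotChar (e : AddChar K ℂ) (y : ι → K) : AddChar (ι → K) ℂ where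
  toFun a := e (y ⬝ᵥ a)
  map_zero_eq_one' := by simp
  map_add_eq_mul' a b := by rw [dotProduct_add, e.map_add_eq_mul]

theorem dotChar_apply (e : AddChar K ℂ) (y a : ι → K) : dotChar e y a = e (y ⬝ᵥ a) := rfl

theorem dotChar_zero (e : AddChar K ℂ) : dotChar e (0 : ι → K) = 1 := by
  ext a
  simp [dotChar_apply]

theorem dotChar_add (e : AddChar K ℂ) (y z : ι → K) :
    dotChar e (y + z) = dotChar e y * dotChar e z := by
  ext a
  simp [dotChar_apply, add_dotProduct, AddChar.map_add_eq_mul]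

theorem dotChar_injective {e : AddChar K ℂ} (he : e.IsPrimitive) :
    Function.Injective (dotChar (ι := ι) e) := by
  classical
  intro y z hyz
  ext j
  refine AddChar.to_mulShift_inj_of_isPrimitive he ?_
  ext t
  simpa [dotChar_apply] using DFunLike.congr_fun hyz (Pi.single j t)

theorem exists_mulShift_eq [Finite K] {e : AddChar K ℂ} (he : e.IsPrimitive) (ξ : AddChar K ℂ) :
    ∃ c, e.mulShift c = ξ := by
  have := Fintype.ofFinite K
  exact ((Fintype.bijective_iff_injective_and_card e.mulShift).2
    ⟨AddChar.to_mulShift_inj_of_isPrimitive he, AddChar.card_eq.symm⟩).2 ξ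

/-- The oracle whose answer to the query `x` is the linear functional `v x` of the hidden
vector. -/
def linearOracle (v : X → ι → K) : (ι → K) →+ X → K :=
  (Matrix.of v).mulVecLin.toAddMonoidHom

theorem linearOracle_apply (v : X → ι → K) (a : ι → K) (x : X) :
    linearOracle v a x = v x ⬝ᵥ a := rfl

theorem evalChar_linearOracle (v : X → ι → K) (e : AddChar K ℂ) (x : X) (c : K) :
    evalChar (linearOracle v) (x, e.mulShift c) = dotChar e (c • v x) := by
  ext a
  simp [evalChar_apply, dotChar_apply, linearOracle_apply, AddChar.mulShift_apply]

theorem evalChars_linearOracle [Finite K] [Nonempty X] (v : X → ι → K) {e : AddChar K ℂ}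
    (he : e.IsPrimitive) (q : ℕ) :
    evalChars (linearOracle v) q = dotChar e '' sparseCombinations K v q := by
  induction q with
  | zero => simp [evalChars, sparseCombinations_zero, dotChar_zero, Set.singleton_one]
  | succ q ih =>
    rw [evalChars, pow_succ, ← evalChars, ih, sparseCombinations_succ]
    ext χ
    constructor
    · rintro ⟨_, ⟨y, hy, rfl⟩, _, ⟨⟨x, ξ⟩, rfl⟩, rfl⟩
      obtain ⟨c, rfl⟩ := exists_mulShift_eq he ξ
      exact ⟨_, ⟨y, hy, (x, c), Set.mem_univ _, rfl⟩, by
        simp only [dotChar_add, evalChar_linearOracle]⟩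
    · rintro ⟨_, ⟨y, hy, ⟨x, c⟩, -, rfl⟩, rfl⟩
      exact ⟨_, ⟨y, hy, rfl⟩, _, ⟨(x, e.mulShift c), rfl⟩, by
        simp only [dotChar_add, evalChar_linearOracle]⟩

theorem ncard_evalChars_linearOracle [Finite K] [Nonempty X] (v : X → ι → K) {e : AddChar K ℂ}
    (he : e.IsPrimitive) (q : ℕ) :
    (evalChars (linearOracle v) q).ncard = (sparseCombinations K v q).ncard := by
  rw [evalChars_linearOracle v he, Set.ncard_image_of_injective _ (dotChar_injective he)]

end LinearOracle

section Counting

theorem sq_card_le_card_image_mul_card_collisions {α β : Type*} [DecidableEq β] (s : Finset α)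
    (f : α → β) : #s ^ 2 ≤ #(s.image f) * #{p ∈ s ×ˢ s | f p.1 = f p.2} := by
  have hfiber : #{p ∈ s ×ˢ s | f p.1 = f p.2} = ∑ y ∈ s.image f, #{a ∈ s | f a = y} ^ 2 := by
    rw [card_eq_sum_card_fiberwise (f := fun p => f p.1) (t := s.image f) fun p hp =>
      mem_image_of_mem _ (mem_product.1 (mem_filter.1 hp).1).1]
    refine sum_congr rfl fun y _ => ?_
    rw [sq, ← card_product]
    congr 1
    ext p
    simp only [mem_filter, mem_product]
    grind
  rw [hfiber, card_eq_sum_card_image f s]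
  exact_mod_cast sq_sum_le_card_mul_sum_sq (α := ℕ)

variable {X K V : Type*} [Ring K] [AddCommGroup V] [Module K V]

variable (K) in
/-- Any at most `r` members of the family `v` are linearly independent. -/
def LinearIndepUpTo (v : X → V) (r : ℕ) : Prop :=
  ∀ S : Finset X, #S ≤ r → LinearIndepOn K v (S : Set X)

open Classical in
/-- The functions supported on exactly `k` elements of `T`. -/
def weightFuns (K : Type*) [Ring K] [Fintype K] (T : Finset X) (k : ℕ) : Finset (X →₀ K) :=
  (powersetCard k T).biUnion fun S => S.finsupp fun _ => univ.erase 0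

theorem mem_finsupp_erase_zero [Fintype K] [DecidableEq K] {S : Finset X} {f : X →₀ K} :
    (f ∈ S.finsupp fun _ => univ.erase 0) ↔ f.support = S := by
  rw [mem_finsupp_iff]
  simp only [mem_erase, mem_univ, and_true]
  refine ⟨fun h => h.1.antisymm fun x hx => Finsupp.mem_support_iff.2 (h.2 x hx), ?_⟩
  rintro rfl
  exact ⟨subset_rfl, fun x => Finsupp.mem_support_iff.1⟩

theorem mem_weightFuns [Fintype K] {T : Finset X} {k : ℕ} {f : X →₀ K} :
    f ∈ weightFuns K T k ↔ f.support ⊆ T ∧ #f.support = k := by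
  simp [weightFuns, mem_finsupp_erase_zero, mem_powersetCard]

theorem card_weightFuns [Fintype K] (T : Finset X) (k : ℕ) :
    #(weightFuns K T k) = (#T).choose k * (Fintype.card K - 1) ^ k := by
  classical
  rw [weightFuns, card_biUnion fun S _ S' _ hne => disjoint_left.2 fun f hf hf' =>
    hne ((mem_finsupp_erase_zero.1 hf).symm.trans (mem_finsupp_erase_zero.1 hf')),
    ← card_powersetCard, ← smul_eq_mul, ← sum_const]
  refine sum_congr rfl fun S hS => ?_
  rw [card_finsupp, prod_const, card_erase_of_mem (mem_univ _), card_univ,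
    (mem_powersetCard.1 hS).2]

theorem card_image_weightFuns_le [Fintype K] [Finite X] [DecidableEq V] (v : X → V) (T : Finset X)
    (k : ℕ) : #((weightFuns K T k).image (Finsupp.linearCombination K v)) ≤
      (sparseCombinations K v k).ncard := by
  rw [← Set.ncard_coe_finset, coe_image]
  exact Set.ncard_le_ncard (Set.image_mono fun f hf => (mem_weightFuns.1 hf).2.le)
    (finite_sparseCombinations v k)

namespace LinearIndepUpTo

variable {v : X → V} {r k : ℕ}

theorem eq_of_linearCombination_eq [DecidableEq X] (hv : LinearIndepUpTo K v r) {f g : X →₀ K}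
    (hcard : #(f.support ∪ g.support) ≤ r)
    (h : Finsupp.linearCombination K v f = Finsupp.linearCombination K v g) : f = g :=
  linearIndepOn_iffₛ.1 (hv _ hcard)
    f (by simp [Finsupp.mem_supported]) g (by simp [Finsupp.mem_supported]) h

theorem choose_mul_pow_le_ncard_sparseCombinations [Fintype K] [Finite X]
    (hv : LinearIndepUpTo K v r) (hk : 2 * k ≤ r) (T : Finset X) :
    (#T).choose k * (Fintype.card K - 1) ^ k ≤ (sparseCombinations K v k).ncard := by
  classical
  have hinj : Set.InjOn (Finsupp.linearCombination K v) (weightFuns K T k) := by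
    intro f hf g hg h
    refine hv.eq_of_linearCombination_eq ((card_union_le _ _).trans ?_) h
    rw [(mem_weightFuns.1 hf).2, (mem_weightFuns.1 hg).2]
    omega
  rw [← card_weightFuns, ← card_image_of_injOn hinj]
  exact card_image_weightFuns_le v T k

theorem disjoint_support (hv : LinearIndepUpTo K v r) {f g : X →₀ K}
    (hcard : #f.support + #g.support ≤ r + 1) (hne : f ≠ g)
    (h : Finsupp.linearCombination K v f = Finsupp.linearCombination K v g) :
    Disjoint f.support g.support := by
  classical
  rw [← card_union_eq_card_add_card]
  refine (card_union_le _ _).antisymm (hcard.trans ?_)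
  by_contra! hlt
  exact hne (hv.eq_of_linearCombination_eq (Nat.lt_succ_iff.1 hlt) h)

theorem eq_of_collisions (hv : LinearIndepUpTo K v r) {f g f' g' : X →₀ K}
    (hcard : #f.support + #g.support ≤ r + 1) (hdisj : Disjoint f.support g.support)
    (hf : f'.support = f.support) (hg : g'.support = g.support)
    (h : Finsupp.linearCombination K v f = Finsupp.linearCombination K v g)
    (h' : Finsupp.linearCombination K v f' = Finsupp.linearCombination K v g')
    {x : X} (hx : x ∈ f.support) (hfx : f x = f' x) : f = f' ∧ g = g' := by
  classical
  have hfsub : (f - f').support ⊆ f.support.erase x := fun y hy => by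
    refine mem_erase.2 ⟨?_, ?_⟩
    · rintro rfl
      simp [hfx] at hy
    · simpa [hf] using Finsupp.support_sub hy
  have hgsub : (g - g').support ⊆ g.support := by
    simpa [hg] using Finsupp.support_sub (f := g) (g := g')
  have heq : f - f' = g - g' := by
    refine hv.eq_of_linearCombination_eq ?_ (by rw [map_sub, map_sub, h, h'])
    calc #((f - f').support ∪ (g - g').support) ≤ #(f.support.erase x) + #g.support :=
          (card_union_le _ _).trans (add_le_add (card_le_card hfsub) (card_le_card hgsub))
      _ ≤ r := by
          rw [card_erase_of_mem hx]
          have := card_pos.2 ⟨x, hx⟩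
          omega
  have hzero : f - f' = 0 := by
    rw [← Finsupp.support_eq_empty, ← disjoint_self_iff_empty]
    exact hdisj.mono (hfsub.trans (erase_subset _ _)) (heq ▸ hgsub)
  exact ⟨sub_eq_zero.1 hzero, sub_eq_zero.1 (heq ▸ hzero)⟩

theorem card_collisions_le [Fintype K] [DecidableEq V]
    (hv : LinearIndepUpTo K v r) (hk : 0 < k) (hkr : 2 * k ≤ r + 1) (T : Finset X) :
    #{p ∈ weightFuns K T k ×ˢ weightFuns K T k |
        Finsupp.linearCombination K v p.1 = Finsupp.linearCombination K v p.2} ≤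
      #(weightFuns K T k) + (Fintype.card K - 1) * (#T).choose k ^ 2 := by
  classical
  set W := weightFuns K T k
  set C := {p ∈ W ×ˢ W | Finsupp.linearCombination K v p.1 = Finsupp.linearCombination K v p.2}
  have hdiag : #{p ∈ C | p.1 = p.2} ≤ #W := by
    rw [← diag_card W]
    refine card_le_card fun p hp => ?_
    grind
  have hoff : #{p ∈ C | p.1 ≠ p.2} ≤ (Fintype.card K - 1) * (#T).choose k ^ 2 := by
    rw [sq, ← card_powersetCard, ← card_product]
    refine card_le_mul_card_image_of_maps_to (f := fun p => (p.1.support, p.2.support))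
      (fun p hp => ?_) _ fun S hS => ?_
    · simp only [C, W, mem_filter, mem_product, mem_weightFuns] at hp
      simpa only [mem_product, mem_powersetCard] using hp.1.1
    · obtain ⟨x, hx⟩ : S.1.Nonempty := by
        rw [← card_pos, (mem_powersetCard.1 (mem_product.1 hS).1).2]
        exact hk
      rw [← card_univ, ← card_erase_of_mem (mem_univ (0 : K))]
      refine card_le_card_of_injOn (fun p => p.1 x) ?_ ?_
      · rintro ⟨f, g⟩ hp
        grind
      · rintro ⟨f, g⟩ hp ⟨f', g'⟩ hp' hx'
        simp only [C, W, mem_coe, mem_filter, mem_product, mem_weightFuns] at hp hp'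
        obtain ⟨⟨⟨⟨⟨-, hf⟩, -, hg⟩, h⟩, hne⟩, rfl⟩ := hp
        obtain ⟨⟨⟨-, h'⟩, -⟩, hsupp⟩ := hp'
        have hcard : #f.support + #g.support ≤ r + 1 := by omega
        obtain ⟨rfl, rfl⟩ := hv.eq_of_collisions hcard (hv.disjoint_support hcard hne h)
          (congrArg Prod.fst hsupp) (congrArg Prod.snd hsupp) h h' hx hx'
        rfl
  rw [← card_filter_add_card_filter_not (s := C) fun p => p.1 = p.2]
  exact add_le_add hdiag hoff

theorem choose_mul_pow_le_card_image_mul [Fintype K] [DecidableEq V] {l : ℕ}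
    (hv : LinearIndepUpTo K v (2 * l + 1)) (T : Finset X) :
    (#T).choose (l + 1) * (Fintype.card K - 1) ^ (2 * l + 1) ≤
      #((weightFuns K T (l + 1)).image (Finsupp.linearCombination K v)) *
        ((Fintype.card K - 1) ^ l + (#T).choose (l + 1)) := by
  classical
  have hsq := (sq_card_le_card_image_mul_card_collisions (weightFuns K T (l + 1))
    (Finsupp.linearCombination K v)).trans
      (Nat.mul_le_mul_left _ (hv.card_collisions_le l.succ_pos (by omega) T))
  rw [card_weightFuns] at hsq
  set C := (#T).choose (l + 1)
  set m := Fintype.card K - 1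
  set I := #((weightFuns K T (l + 1)).image (Finsupp.linearCombination K v))
  rcases (C * m).eq_zero_or_pos with h0 | hpos
  · rw [pow_succ', ← mul_assoc, h0, zero_mul]
    exact Nat.zero_le _
  refine le_of_mul_le_mul_left ?_ hpos
  calc C * m * (C * m ^ (2 * l + 1)) = (C * m ^ (l + 1)) ^ 2 := by ring
    _ ≤ I * (C * m ^ (l + 1) + m * C ^ 2) := hsq
    _ = C * m * (I * (m ^ l + C)) := by ring

end LinearIndepUpTo

end Counting

section Numerics

theorem one_add_choose_two_le_factorial {k : ℕ} (hk : 0 < k) : 1 + k.choose 2 ≤ k.factorial := by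
  induction k, hk using Nat.le_induction with
  | base => decide
  | succ k hk ih =>
    rw [Nat.choose_succ_succ' k 1, Nat.choose_one_right, Nat.factorial_succ]
    nlinarith [Nat.self_le_factorial k, Nat.factorial_pos k]

theorem pow_succ_le_descFactorial_add (n q : ℕ) :
    n ^ (q + 1) ≤ n.descFactorial (q + 1) + (q + 1).choose 2 * n ^ q := by
  induction q with
  | zero => simp
  | succ q ih =>
    rw [Nat.choose_succ_succ' (q + 1) 1, Nat.choose_one_right, n.descFactorial_succ (q + 1)]
    set D := n.descFactorial (q + 1)
    set c := (q + 1).choose 2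
    calc n ^ (q + 1 + 1) = n ^ (q + 1) * n := pow_succ _ _
      _ ≤ (D + c * n ^ q) * n := by gcongr
      _ ≤ D * ((n - (q + 1)) + (q + 1)) + c * n ^ (q + 1) := by
          rw [add_mul, mul_assoc c, ← pow_succ]
          gcongr
          exact le_tsub_add
      _ = (n - (q + 1)) * D + (D * (q + 1) + c * n ^ (q + 1)) := by ring
      _ ≤ (n - (q + 1)) * D + (n ^ (q + 1) * (q + 1) + c * n ^ (q + 1)) := by
          gcongr
          exact Nat.descFactorial_le_pow n (q + 1)
      _ = (n - (q + 1)) * D + (q + 1 + c) * n ^ (q + 1) := by ring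

theorem add_sub_one_le_mul {a b : ℝ} (ha : a ≤ 1) (hb : b ≤ 1) : a + b - 1 ≤ a * b := by
  linarith [mul_nonneg (sub_nonneg.2 ha) (sub_nonneg.2 hb)]

theorem one_sub_div_le_pow {n : ℕ} (hn : 0 < n) (q : ℕ) :
    1 - (q : ℝ) / n ≤ ((n - 1 : ℕ) / n : ℝ) ^ q := by
  have hn' : (1 : ℝ) ≤ n := Nat.one_le_cast.2 hn
  have hinv : (n : ℝ)⁻¹ ≤ 1 := inv_le_one_of_one_le₀ hn'
  calc 1 - (q : ℝ) / n = 1 + q * -(n : ℝ)⁻¹ := by ring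
    _ ≤ (1 + -(n : ℝ)⁻¹) ^ q := one_add_mul_le_pow (by linarith) q
    _ = ((n - 1 : ℕ) / n : ℝ) ^ q := by
        rw [Nat.cast_pred hn]
        field_simp
        ring

theorem one_sub_choose_two_div_le_descFactorial_div {n : ℕ} (hn : 0 < n) (q : ℕ) :
    1 - (q.choose 2 : ℝ) / n ≤ n.descFactorial q / (n : ℝ) ^ q := by
  have : (0 : ℝ) < n := Nat.cast_pos.2 hn
  cases q with
  | zero => simp
  | succ q =>
    have h : (n : ℝ) ^ (q + 1) ≤ n.descFactorial (q + 1) + (q + 1).choose 2 * n ^ q := by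
      exact_mod_cast pow_succ_le_descFactorial_add n q
    calc 1 - ((q + 1).choose 2 : ℝ) / n
        = ((n : ℝ) ^ (q + 1) - (q + 1).choose 2 * n ^ q) / (n : ℝ) ^ (q + 1) := by
          rw [sub_div, div_self (by positivity), pow_succ]
          field_simp
      _ ≤ n.descFactorial (q + 1) / (n : ℝ) ^ (q + 1) := by
          gcongr
          linarith

theorem one_sub_choose_two_div_le_choose_mul_pow_div {n : ℕ} (hn : 0 < n) (q : ℕ) :
    1 / (q.factorial : ℝ) * (1 - ((q + 1).choose 2 : ℝ) * (1 / (n : ℝ))) ≤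
      (n.choose q * (n - 1) ^ q : ℕ) / (n : ℝ) ^ (2 * q) := by
  have : (0 : ℝ) < n := Nat.cast_pos.2 hn
  have hdesc : (n.descFactorial q / (n : ℝ) ^ q : ℝ) ≤ 1 :=
    div_le_one_of_le₀ (by exact_mod_cast Nat.descFactorial_le_pow n q) (by positivity)
  have hpow : ((n - 1 : ℕ) / n : ℝ) ^ q ≤ 1 :=
    pow_le_one₀ (by positivity) (div_le_one_of_le₀ (by exact_mod_cast n.sub_le 1) (by positivity))
  calc 1 / (q.factorial : ℝ) * (1 - ((q + 1).choose 2 : ℝ) * (1 / (n : ℝ)))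
      = 1 / (q.factorial : ℝ) * ((1 - (q.choose 2 : ℝ) / n) + (1 - (q : ℝ) / n) - 1) := by
        rw [Nat.choose_succ_succ' q 1, Nat.choose_one_right]
        push_cast
        ring
    _ ≤ 1 / (q.factorial : ℝ) *
          ((n.descFactorial q / (n : ℝ) ^ q) * ((n - 1 : ℕ) / n : ℝ) ^ q) := by
        gcongr
        refine le_trans ?_ (add_sub_one_le_mul hdesc hpow)
        gcongr
        · exact one_sub_choose_two_div_le_descFactorial_div hn q
        · exact one_sub_div_le_pow hn q
    _ = (n.choose q * (n - 1) ^ q : ℕ) / (n : ℝ) ^ (2 * q) := by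
        rw [Nat.descFactorial_eq_factorial_mul_choose, div_pow, two_mul, pow_add]
        push_cast
        field_simp

theorem choose_mul_pow_div_le_one_div_factorial {n : ℕ} (hn : 0 < n) (q : ℕ) :
    (n.choose q * n ^ q : ℕ) / (n : ℝ) ^ (2 * q) ≤ 1 / q.factorial := by
  have : (0 : ℝ) < n := Nat.cast_pos.2 hn
  calc ((n.choose q * n ^ q : ℕ) : ℝ) / (n : ℝ) ^ (2 * q)
      = n.choose q / (n : ℝ) ^ q := by
        rw [two_mul, pow_add]
        push_cast
        field_simp
    _ ≤ ((n : ℝ) ^ q / q.factorial) / (n : ℝ) ^ q := by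
        gcongr
        exact Nat.choose_le_pow_div q n
    _ = 1 / q.factorial := by field_simp

theorem succ_mul_pow_le_factorial_mul (m l : ℕ) :
    (m + 1) * m ^ l ≤ (l + 1).factorial * (m ^ l + m.choose (l + 1)) :=
  calc (m + 1) * m ^ l = m ^ (l + 1) + m ^ l := by ring
    _ ≤ m.descFactorial (l + 1) + (l + 1).choose 2 * m ^ l + m ^ l := by
        gcongr
        exact pow_succ_le_descFactorial_add m l
    _ = (1 + (l + 1).choose 2) * m ^ l + (l + 1).factorial * m.choose (l + 1) := by
        rw [Nat.descFactorial_eq_factorial_mul_choose]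
        ring
    _ ≤ (l + 1).factorial * m ^ l + (l + 1).factorial * m.choose (l + 1) := by
        gcongr
        exact one_add_choose_two_le_factorial l.succ_pos
    _ = (l + 1).factorial * (m ^ l + m.choose (l + 1)) := by ring

theorem succ_mul_pow_le_add_factorial_mul_pow {m l I : ℕ}
    (hI : m.choose (l + 1) * m ^ (2 * l + 1) ≤ I * (m ^ l + m.choose (l + 1))) :
    (m + 1) * m ^ (2 * l + 1) ≤ (m + 1) * I + (l + 1).factorial * m ^ (2 * l + 1) := by
  rcases m.eq_zero_or_pos with rfl | hm
  · simp
  set C := m.choose (l + 1)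
  set M := m ^ (2 * l + 1)
  refine le_of_mul_le_mul_left ?_ (show 0 < m ^ l + C by positivity)
  calc (m ^ l + C) * ((m + 1) * M) = (m + 1) * m ^ l * M + (m + 1) * (C * M) := by ring
    _ ≤ (l + 1).factorial * (m ^ l + C) * M + (m + 1) * (I * (m ^ l + C)) := by
        gcongr ?_ * M + _ * ?_
        exact succ_mul_pow_le_factorial_mul m l
    _ = (m ^ l + C) * ((m + 1) * I + (l + 1).factorial * M) := by ring

theorem one_sub_le_div_of_choose_mul_pow_le {m l I : ℕ}
    (hI : m.choose (l + 1) * m ^ (2 * l + 1) ≤ I * (m ^ l + m.choose (l + 1))) :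
    1 - ((l + 1).factorial + (2 * l : ℕ) + 1 : ℝ) / (m + 1 : ℕ) ≤
      I / ((m + 1 : ℕ) : ℝ) ^ (2 * l + 1) := by
  have hM : ((m : ℝ) + 1) * m ^ (2 * l + 1) ≤
      (m + 1) * I + (l + 1).factorial * (m : ℝ) ^ (2 * l + 1) := by
    exact_mod_cast succ_mul_pow_le_add_factorial_mul_pow hI
  have hbern := one_sub_div_le_pow m.succ_pos (2 * l + 1)
  rw [Nat.succ_eq_add_one, Nat.add_sub_cancel] at hbern
  set n : ℝ := ((m + 1 : ℕ) : ℝ) with hn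
  rw [Nat.cast_succ] at hn
  rw [← hn] at hM
  have hn0 : 0 < n := by positivity
  have hfrac : (1 - (l + 1).factorial / n) * (m : ℝ) ^ (2 * l + 1) ≤ I := by
    rw [one_sub_div hn0.ne', div_mul_eq_mul_div, div_le_iff₀ hn0]
    linarith
  have ha : 1 - (l + 1).factorial / n ≤ 1 := sub_le_self _ (by positivity)
  have hb : (m / n : ℝ) ^ (2 * l + 1) ≤ 1 :=
    pow_le_one₀ (by positivity) (div_le_one_of_le₀ (by simp [n]) (by positivity))
  calc 1 - ((l + 1).factorial + (2 * l : ℕ) + 1 : ℝ) / n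
      = (1 - (l + 1).factorial / n) + (1 - (2 * l + 1 : ℕ) / n) - 1 := by
        push_cast
        ring
    _ ≤ (1 - (l + 1).factorial / n) * (m / n) ^ (2 * l + 1) := by
        refine le_trans ?_ (add_sub_one_le_mul ha hb)
        gcongr
    _ ≤ I / n ^ (2 * l + 1) := by
        rw [div_pow, ← mul_div_assoc]
        gcongr

end Numerics

section Polynomials

variable {F : Type*} [Field F]

/-- The node `x` of the moment curve in dimension `d + 1`. -/
def powers (d : ℕ) (x : F) (j : Fin (d + 1)) : F := x ^ (j : ℕ)

theorem linearIndepUpTo_powers (d : ℕ) : LinearIndepUpTo F (powers (F := F) d) (d + 1) := by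
  intro S hS
  rw [LinearIndepOn, Fintype.linearIndependent_iff]
  intro c hc x
  let t := S.equivFin.symm
  have hzero := Matrix.eq_zero_of_forall_pow_sum_mul_pow_eq_zero (n := #S)
    (f := fun i => (t i : F)) (v := fun i => c (t i))
    (Subtype.val_injective.comp t.injective) fun i => by
      have hi := congrFun hc ⟨i, by omega⟩
      rw [Equiv.sum_comp t fun x : S => c x * (x : F) ^ (i : ℕ)]
      simpa [powers] using hi
  simpa using congrFun hzero (t.symm x)

theorem polyFun_eq_linearOracle {d : ℕ} (a : Fin (d + 1) → F) :
    polyFun a = linearOracle (powers d) a := by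
  ext x
  simp only [polyFun, linearOracle_apply, dotProduct, powers, mul_comm]

theorem exists_linearCombination_powers_succ (d : ℕ) {f : F →₀ F} (hf : 0 ∉ f.support) :
    ∃ g : F →₀ F, #g.support ≤ #f.support ∧
      ∀ j, Finsupp.linearCombination F (powers (d + 1)) g (Fin.succ j) =
        Finsupp.linearCombination F (powers d) f j := by
  classical
  refine ⟨Finsupp.onFinset f.support (fun x => x⁻¹ * f x) fun x hx =>
    Finsupp.mem_support_iff.2 (right_ne_zero_of_mul hx),
    card_le_card Finsupp.support_onFinset_subset, fun j => ?_⟩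
  rw [Finsupp.linearCombination_apply, Finsupp.linearCombination_apply,
    Finsupp.onFinset_sum _ (by simp)]
  simp only [Finsupp.sum, Finset.sum_apply, Pi.smul_apply, powers, Fin.val_succ, smul_eq_mul]
  refine sum_congr rfl fun x hx => ?_
  have hx0 : x ≠ 0 := fun h => hf (h ▸ hx)
  field_simp
  ring

theorem cons_mem_sparseCombinations {d : ℕ} (c : F) {f : F →₀ F} (hf : 0 ∉ f.support) :
    (Fin.cons c (Finsupp.linearCombination F (powers d) f) : Fin (d + 2) → F) ∈
      sparseCombinations F (powers (d + 1)) (#f.support + 1) := by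
  obtain ⟨g, hg, htail⟩ := exists_linearCombination_powers_succ d hf
  rw [sparseCombinations_succ]
  refine ⟨_, ⟨g, hg, rfl⟩,
    (0, c - Finsupp.linearCombination F (powers (d + 1)) g 0), Set.mem_univ _, ?_⟩
  funext j
  refine Fin.cases ?_ (fun j => ?_) j
  · simp [powers]
  · simp [powers, htail]

variable [Fintype F]

/-- The fraction of the vectors of `F ^ (d + 1)` that are combinations of at most `q` points of
the moment curve. -/
def sparseFraction (F : Type*) [Field F] [Fintype F] (d q : ℕ) : ℝ :=
  (sparseCombinations F (powers (F := F) d) q).ncard / (Fintype.card F : ℝ) ^ (d + 1)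

theorem PhaseEquivalent.isGreatest_interpolationProbs {R : Type*} [Fintype R] [Nonempty R]
    {query : (F → F) → (w : ℕ) → StateSpace F R w → StateSpace F R w}
    (h : PhaseEquivalent query) (d q : ℕ) :
    IsGreatest (interpolationProbs query d q) (sparseFraction F d q) := by
  have hgreatest := h.isGreatest_identificationProbs (linearOracle (powers (F := F) d)) q
  rw [ncard_evalChars_linearOracle _ (AddChar.FiniteField.primitiveChar_to_Complex_isPrimitive F)]
    at hgreatest
  simpa [identificationProbs, interpolationProbs, sparseFraction, polyFun_eq_linearOracle]
    using hgreatest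

theorem sparseFraction_le_one_div_card {d q : ℕ} (hq : 2 * q ≤ d) :
    sparseFraction F d q ≤ 1 / Fintype.card F := by
  have hn : 0 < Fintype.card F := Fintype.card_pos
  have hcard : (sparseCombinations F (powers (F := F) d) q).ncard ≤ Fintype.card F ^ d :=
    calc _ ≤ (Fintype.card F * Fintype.card F) ^ q := by
          simpa only [Nat.card_eq_fintype_card] using
            ncard_sparseCombinations_le_pow (K := F) (powers (F := F) d) q
      _ = Fintype.card F ^ (2 * q) := by rw [← sq, pow_mul]
      _ ≤ Fintype.card F ^ d := Nat.pow_le_pow_right hn hq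
  calc sparseFraction F d q ≤ (Fintype.card F : ℝ) ^ d / (Fintype.card F : ℝ) ^ (d + 1) := by
        unfold sparseFraction
        gcongr
        exact_mod_cast hcard
    _ = 1 / Fintype.card F := by
        rw [pow_succ]
        field_simp

theorem le_sparseFraction {d q : ℕ} (hq : 2 * q = d + 1) :
    1 / (q.factorial : ℝ) * (1 - ((q + 1).choose 2 : ℝ) * (1 / (Fintype.card F : ℝ))) ≤
      sparseFraction F d q := by
  refine (one_sub_choose_two_div_le_choose_mul_pow_div Fintype.card_pos q).trans ?_
  have hcard := (linearIndepUpTo_powers (F := F) d).choose_mul_pow_le_ncard_sparseCombinations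
    hq.le univ
  rw [card_univ] at hcard
  rw [hq, sparseFraction]
  gcongr

theorem sparseFraction_le_one_div_factorial {d q : ℕ} (hq : 2 * q = d + 1)
    (hn : q ≤ Fintype.card F) : sparseFraction F d q ≤ 1 / q.factorial := by
  refine le_trans ?_ (choose_mul_pow_div_le_one_div_factorial (Fintype.card_pos (α := F)) q)
  rw [hq, sparseFraction]
  gcongr
  exact ncard_sparseCombinations_le_choose_mul_pow (powers d) hn

theorem card_mul_card_image_weightFuns_le [DecidableEq F] (d k : ℕ) :
    Fintype.card F * #((weightFuns F (univ.erase (0 : F)) k).image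
        (Finsupp.linearCombination F (powers d))) ≤
      (sparseCombinations F (powers (F := F) (d + 1)) (k + 1)).ncard := by
  rw [← card_univ, ← card_product, ← Set.ncard_coe_finset]
  refine Set.ncard_le_ncard_of_injOn
    (fun p : F × (Fin (d + 1) → F) => (Fin.cons p.1 p.2 : Fin (d + 2) → F)) ?_ ?_
    (finite_sparseCombinations _ _)
  · rintro ⟨c, y⟩ hp
    obtain ⟨f, hf, rfl⟩ := mem_image.1 (mem_product.1 hp).2
    obtain ⟨hsupp, rfl⟩ := mem_weightFuns.1 hf
    exact cons_mem_sparseCombinations c fun h => (mem_erase.1 (hsupp h)).1 rfl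
  · rintro ⟨c, y⟩ - ⟨c', y'⟩ - h
    simpa [Prod.ext_iff] using Fin.cons_injective2 h

theorem one_sub_le_card_image_weightFuns_div [DecidableEq F] (l : ℕ) :
    1 - ((l + 1).factorial + (2 * l : ℕ) + 1 : ℝ) / Fintype.card F ≤
      #((weightFuns F (univ.erase (0 : F)) (l + 1)).image
        (Finsupp.linearCombination F (powers (2 * l)))) / (Fintype.card F : ℝ) ^ (2 * l + 1) := by
  have hI := (linearIndepUpTo_powers (2 * l)).choose_mul_pow_le_card_image_mul (univ.erase (0 : F))
  rw [card_erase_of_mem (mem_univ _), card_univ] at hI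
  simpa only [Nat.sub_add_cancel (Fintype.card_pos (α := F))] using
    one_sub_le_div_of_choose_mul_pow_le hI

theorem one_sub_le_sparseFraction {d q : ℕ} (hq : d + 2 ≤ 2 * q) :
    1 - ((d / 2 + 1).factorial + d + 1 : ℝ) / Fintype.card F ≤ sparseFraction F d q := by
  classical
  rw [sparseFraction]
  rcases d.even_or_odd' with ⟨l, rfl | rfl⟩
  · rw [Nat.mul_div_cancel_left l two_pos]
    refine (one_sub_le_card_image_weightFuns_div l).trans ?_
    gcongr
    exact (card_image_weightFuns_le _ _ _).trans <|
      Set.ncard_le_ncard (sparseCombinations_mono _ (by omega)) (finite_sparseCombinations _ _)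
  · have hcard := (card_mul_card_image_weightFuns_le (F := F) (2 * l) (l + 1)).trans <|
      Set.ncard_le_ncard (sparseCombinations_mono _ (by omega : l + 1 + 1 ≤ q))
        (finite_sparseCombinations _ _)
    set I := #((weightFuns F (univ.erase (0 : F)) (l + 1)).image
      (Finsupp.linearCombination F (powers (2 * l))))
    calc _ ≤ 1 - ((l + 1).factorial + (2 * l : ℕ) + 1 : ℝ) / Fintype.card F := by
          rw [show (2 * l + 1) / 2 = l by omega]
          gcongr
          omega
      _ ≤ I / (Fintype.card F : ℝ) ^ (2 * l + 1) := one_sub_le_card_image_weightFuns_div l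
      _ = (Fintype.card F * I : ℕ) / (Fintype.card F : ℝ) ^ (2 * l + 1 + 1) := by
          push_cast
          rw [pow_succ' _ (2 * l + 1), mul_div_mul_left _ _ (by simp)]
      _ ≤ _ := by gcongr

end Polynomials

end QuantumQuery

end

theorem theorem5p3 {F : Type*} [Field F] [Fintype F] (d q : ℕ) :
    ∃ P : ℝ,
      IsGreatest (QuantumQuery.interpolationProbs (F := F) QuantumQuery.phaseQuery d q) P ∧
      IsGreatest (QuantumQuery.interpolationProbs (F := F) QuantumQuery.addQuery d q) P ∧
      ((q : ℝ) ≤ (d : ℝ) / 2 → P ≤ 1 / (Fintype.card F : ℝ)) ∧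
      ((q : ℝ) = (d : ℝ) / 2 + 1 / 2 →
        1 / (q.factorial : ℝ) * (1 - ((q + 1).choose 2 : ℝ) * (1 / (Fintype.card F : ℝ))) ≤ P ∧
        (q ≤ Fintype.card F → P ≤ 1 / (q.factorial : ℝ))) ∧
      ((d : ℝ) / 2 + 1 ≤ (q : ℝ) →
        1 - (((d / 2 + 1).factorial : ℝ) + (d : ℝ) + 1) / (Fintype.card F : ℝ) ≤ P) := by
  refine ⟨_, QuantumQuery.phaseEquivalent_phaseQuery.isGreatest_interpolationProbs d q,
    QuantumQuery.phaseEquivalent_addQuery.isGreatest_interpolationProbs d q,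
    fun hq => ?_, fun hq => ?_, fun hq => ?_⟩
  · exact QuantumQuery.sparseFraction_le_one_div_card (by rify; linarith)
  · have hq' : 2 * q = d + 1 := by rify; linarith
    exact ⟨QuantumQuery.le_sparseFraction hq',
      QuantumQuery.sparseFraction_le_one_div_factorial hq'⟩
  · exact QuantumQuery.one_sub_le_sparseFraction (by rify; linarith)
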